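/- Lemma (Braid action on a free groupoid in the plane). Let $n$ be a natural number and $0<\epsilon<1/2$. Let $B_n$ be the braid group with Artin generators $\tau_1,\dots,\tau_{n-1}$ and relations $\tau_i\tau_j=\tau_j\tau_i$ for $|i-j|\ge 2$ and $\tau_i\tau_{i+1}\tau_i=\tau_{i+1}\tau_i\tau_{i+1}$. Let $G$ be the free groupoid with set of objects the $2n+1$ distinct points $\{0+\epsilon,\,1\pm\epsilon,\dots,n\pm\epsilon\}$, base point $P:=0+\epsilon$, and free generating morphisms $w_k\in\mathrm{Hom}_G(k+\epsilon,\,k+1-\epsilon)$ for $0\le k\le n-1$ and $l_k^{\pm}\in\mathrm{Hom}_G(k\mp\epsilon,\,k\pm\epsilon)$ for $1\le k\le n$. Morphisms are composed in path order ($ab$ is first $a$, then $b$). Let $\mathrm{Aut}(G,P)$ be the group of automorphisms of the groupoid $G$ (invertible functors $G\to G$, under composition) that fix the object $P$. Then there is a unique group homomorphism $B_n\to\mathrm{Aut}(G,P)$ under which, for $1\le i\le n-1$, the generator $\tau_i$ acts on the generating morphisms by $$ w_j\mapsto\begin{cases} w_j, & j\notin\{i-1,i,i+1\},\\ w_{i-1}\,l_i^+\,w_i\,l_{i+1}^+,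 & j=i-1,\\ w_i^{-1}, & j=i,\\ (l_i^-)^{-1}\,w_i\,(l_{i+1}^-)^{-1}\,w_{i+1}, & j=i+1,\end{cases} \qquad l_j^{\pm}\mapsto\begin{cases} l_j^{\pm}, & j\notin\{i,i+1\},\\ l_{i+1}^{\mp}, & j=i,\\ l_i^{\mp}, & j=i+1,\end{cases} $$ and this homomorphism is injective. Moreover, put $\gamma_j:=w_0(l_1^-)^{-1}w_1(l_2^-)^{-1}\cdots (l_{j-1}^-)^{-1}w_{j-1}\in\mathrm{Hom}_G(P,\,j-\epsilon)$ and $f_j:=\gamma_j\,l_j^+l_j^-\,\gamma_j^{-1}$ for $1\le j\le n$. Then $\pi_1(G,P):=\mathrm{Hom}_G(P,P)$ is a free group of rank $n$, freely generated by $f_1,\dots,f_n$. Restricted to $\pi_1(G,P)\cong F_n$, the action of $B_n$ is Artin's action, that is, the action of $B_n$ on $F_n$ by group automorphisms in which $$ \tau_i:\quad f_i\mapsto f_i f_{i+1} f_i^{-1},\qquad f_{i+1}\mapsto f_i,\qquad f_j\mapsto f_j\quad (j\ne i,i+1), $$ and Artin's action $B_n\to\mathrm{Aut}(F_n)$ is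 faithful. -/

import Mathlib

open CategoryTheory

namespace PlaneGroupoid

/-! ### The braid group -/

/-- Artin's relators for the braid group on `n` strands. The generators are indexed by
`i : Fin (n - 1)`; the index `i` (counted from `0`) stands for the braid generator `τ_{i+1}`. -/
inductive BraidRelator (n : ℕ) : FreeGroup (Fin (n - 1)) → Prop
  /-- `τ_i τ_j = τ_j τ_i` if `j - i ≥ 2` -/
  | far (i j : Fin (n - 1)) (h : (i : ℕ) + 2 ≤ j) :
      BraidRelator n (FreeGroup.of i * FreeGroup.of j * (FreeGroup.of j * FreeGroup.of i)⁻¹)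
  /-- `τ_i τ_{i+1} τ_i = τ_{i+1} τ_i τ_{i+1}` -/
  | near (i j : Fin (n - 1)) (h : (i : ℕ) + 1 = j) :
      BraidRelator n (FreeGroup.of i * FreeGroup.of j * FreeGroup.of i *
        (FreeGroup.of j * FreeGroup.of i * FreeGroup.of j)⁻¹)

/-- The braid group `B_n`, by Artin's presentation. -/
abbrev BraidGroup (n : ℕ) : Type :=
  PresentedGroup {r : FreeGroup (Fin (n - 1)) | BraidRelator n r}

/-- The braid generator `τ_{i+1}`. -/
def τ {n : ℕ} (i : Fin (n - 1)) : BraidGroup n := PresentedGroup.of i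

/-! ### Artin's action on the free group -/

/-- The index of the free generator `x_{i+1}` of `F_n`, where `τ_{i+1}` is a braid generator.
The index `j : Fin n` (counted from `0`) stands for the generator `x_{j+1}`. -/
def lo {n : ℕ} (i : Fin (n - 1)) : Fin n := ⟨i, by omega⟩

/-- The index of the free generator `x_{i+2}` of `F_n`, where `τ_{i+1}` is a braid generator. -/
def hi {n : ℕ} (i : Fin (n - 1)) : Fin n := ⟨i + 1, by omega⟩

/-- The endomorphism `x_i ↦ x_i x_{i+1} x_i⁻¹`, `x_{i+1} ↦ x_i`, `x_j ↦ x_j` of `F_n`. -/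
def artinHom {n : ℕ} (i : Fin (n - 1)) : FreeGroup (Fin n) →* FreeGroup (Fin n) :=
  FreeGroup.lift fun j =>
    if j = lo i then FreeGroup.of (lo i) * FreeGroup.of (hi i) * (FreeGroup.of (lo i))⁻¹
    else if j = hi i then FreeGroup.of (lo i)
    else FreeGroup.of j

/-- The inverse of `artinHom i`: `x_i ↦ x_{i+1}`, `x_{i+1} ↦ x_{i+1}⁻¹ x_i x_{i+1}`. -/
def artinInv {n : ℕ} (i : Fin (n - 1)) : FreeGroup (Fin n) →* FreeGroup (Fin n) :=
  FreeGroup.lift fun j =>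
    if j = lo i then FreeGroup.of (hi i)
    else if j = hi i then (FreeGroup.of (hi i))⁻¹ * FreeGroup.of (lo i) * FreeGroup.of (hi i)
    else FreeGroup.of j

theorem hi_ne_lo {n : ℕ} (i : Fin (n - 1)) : hi i ≠ lo i := by
  simp [hi, lo]

theorem artinHom_of {n : ℕ} (i : Fin (n - 1)) (j : Fin n) :
    artinHom i (FreeGroup.of j) =
      if j = lo i then FreeGroup.of (lo i) * FreeGroup.of (hi i) * (FreeGroup.of (lo i))⁻¹
      else if j = hi i then FreeGroup.of (lo i)
      else FreeGroup.of j := by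
  simp [artinHom]

theorem artinHom_lo {n : ℕ} (i : Fin (n - 1)) :
    artinHom i (FreeGroup.of (lo i)) =
      FreeGroup.of (lo i) * FreeGroup.of (hi i) * (FreeGroup.of (lo i))⁻¹ := by
  simp [artinHom]

theorem artinHom_hi {n : ℕ} (i : Fin (n - 1)) :
    artinHom i (FreeGroup.of (hi i)) = FreeGroup.of (lo i) := by
  simp [artinHom, hi_ne_lo]

theorem artinHom_else {n : ℕ} (i : Fin (n - 1)) (j : Fin n) (h : j ≠ lo i) (h' : j ≠ hi i) :
    artinHom i (FreeGroup.of j) = FreeGroup.of j := by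
  simp [artinHom, h, h']

/-- The automorphism `x_i ↦ x_i x_{i+1} x_i⁻¹`, `x_{i+1} ↦ x_i`, `x_j ↦ x_j` of `F_n`. -/
def artinAut {n : ℕ} (i : Fin (n - 1)) : MulAut (FreeGroup (Fin n)) :=
  MonoidHom.toMulEquiv (artinHom i) (artinInv i)
    (by
      ext j
      by_cases h : j = lo i
      · subst h; simp [artinHom, artinInv, hi_ne_lo, mul_assoc]
      · by_cases h' : j = hi i
        · subst h'; simp [artinHom, artinInv, hi_ne_lo]
        · simp [artinHom, artinInv, h, h'])
    (by
      ext j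
      by_cases h : j = lo i
      · subst h; simp [artinHom, artinInv, hi_ne_lo]
      · by_cases h' : j = hi i
        · subst h'; simp [artinHom, artinInv, hi_ne_lo, mul_assoc]
        · simp [artinHom, artinInv, h, h'])

theorem artinAut_apply {n : ℕ} (i : Fin (n - 1)) (x : FreeGroup (Fin n)) :
    artinAut i x = artinHom i x := rfl

theorem artin_far {n : ℕ} (i j : Fin (n - 1)) (h : (i : ℕ) + 2 ≤ j) :
    artinAut i * artinAut j = artinAut j * artinAut i := by
  apply MulEquiv.toMonoidHom_injective
  ext k
  have e1 : lo i ≠ lo j := by simp [lo]; omega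
  have e2 : lo i ≠ hi j := by simp [lo, hi]; omega
  have e3 : hi i ≠ lo j := by simp [lo, hi]; omega
  have e4 : hi i ≠ hi j := by simp [hi]; omega
  simp only [MulEquiv.coe_toMonoidHom, MulAut.mul_apply, artinAut_apply]
  have key : ∀ k, k = lo i ∨ k = hi i ∨ k = lo j ∨ k = hi j ∨
    (k ≠ lo i ∧ k ≠ hi i ∧ k ≠ lo j ∧ k ≠ hi j) := by intro k; tauto
  rcases key k with rfl | rfl | rfl | rfl | ⟨h1, h2, h3, h4⟩
  · simp [artinHom_lo, artinHom_else j _ e1 e2, artinHom_else j _ e3 e4]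
  · simp [artinHom_hi, artinHom_else j _ e1 e2, artinHom_else j _ e3 e4]
  · simp [artinHom_lo, artinHom_else i _ e1.symm e3.symm, artinHom_else i _ e2.symm e4.symm]
  · simp [artinHom_hi, artinHom_else i _ e1.symm e3.symm, artinHom_else i _ e2.symm e4.symm]
  · simp [artinHom_else i _ h1 h2, artinHom_else j _ h3 h4]

theorem artin_near {n : ℕ} (i j : Fin (n - 1)) (h : (i : ℕ) + 1 = j) :
    artinAut i * artinAut j * artinAut i = artinAut j * artinAut i * artinAut j := by
  apply MulEquiv.toMonoidHom_injective
  ext k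
  have e : lo j = hi i := by simp [lo, hi, h]
  have e1 : lo i ≠ lo j := by simp [lo]; omega
  have e2 : lo i ≠ hi j := by simp [lo, hi]; omega
  have e4 : hi j ≠ hi i := by simp [hi]; omega
  have a1 := artinHom_else j _ e1 e2
  have a2 := artinHom_else i _ e2.symm e4
  have a3 := artinHom_lo i
  have a4 := artinHom_hi i
  have a5 := artinHom_lo j
  have a6 := artinHom_hi j
  rw [e] at a5 a6
  simp only [MulEquiv.coe_toMonoidHom, MulAut.mul_apply, artinAut_apply]
  have key : ∀ k, k = lo i ∨ k = hi i ∨ k = hi j ∨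
    (k ≠ lo i ∧ k ≠ hi i ∧ k ≠ hi j) := by intro k; tauto
  rcases key k with rfl | rfl | rfl | ⟨h1, h2, h3⟩
  · simp [a1, a2, a3, a4, a5, mul_assoc]
  · simp [a1, a3, a4, a5, a6, a2]
  · simp [a1, a2, a4, a6]
  · simp [artinHom_else i _ h1 h2, artinHom_else j _ (e ▸ h2) h3]

/-- Artin's action of the braid group `B_n` on the free group `F_n = ⟨x_1, …, x_n⟩`. -/
def artinAction (n : ℕ) : BraidGroup n →* MulAut (FreeGroup (Fin n)) :=
  PresentedGroup.toGroup (f := artinAut) <| by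
    rintro r (⟨i, j, h⟩ | ⟨i, j, h⟩)
    · simp only [map_mul, map_inv, FreeGroup.lift_apply_of, artin_far i j h, mul_inv_cancel]
    · simp only [map_mul, map_inv, FreeGroup.lift_apply_of, artin_near i j h, mul_inv_cancel]

/-! ### The free groupoid -/

/-- The objects `0 + ε, 1 ± ε, …, n ± ε`, as symbols. -/
inductive Vertex (n : ℕ) : Type
  /-- the object `k + ε`, for `0 ≤ k ≤ n` -/
  | plus (k : ℕ) (h : k ≤ n) : Vertex n
  /-- the object `k - ε`, for `1 ≤ k ≤ n` -/
  | minus (k : ℕ) (h₁ : 1 ≤ k) (h : k ≤ n) : Vertex n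

/-- The generating morphisms, composed in path order (`a ≫ b` is first `a`, then `b`). -/
inductive Edge (n : ℕ) : Vertex n → Vertex n → Type
  /-- `w_k` from `k + ε` to `k + 1 - ε`, for `0 ≤ k ≤ n - 1` -/
  | w (k : ℕ) (h : k < n) :
      Edge n (.plus k h.le) (.minus (k + 1) (Nat.le_add_left 1 k) h)
  /-- `l_k^+` from `k - ε` to `k + ε`, for `1 ≤ k ≤ n` -/
  | lPlus (k : ℕ) (h₁ : 1 ≤ k) (h : k ≤ n) : Edge n (.minus k h₁ h) (.plus k h)
  /-- `l_k^-` from `k + ε` to `k - ε`, for `1 ≤ k ≤ n` -/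
  | lMinus (k : ℕ) (h₁ : 1 ≤ k) (h : k ≤ n) : Edge n (.plus k h) (.minus k h₁ h)

instance (n : ℕ) : Quiver (Vertex n) where
  Hom := Edge n

/-- The point of the real line that a symbol denotes, for a given `ε`. -/
def Vertex.toReal (ε : ℝ) {n : ℕ} : Vertex n → ℝ
  | .plus k _ => k + ε
  | .minus k _ _ => k - ε

/-- For `0 < ε < 1 / 2` the symbols denote distinct points, so they may stand for these points. -/
theorem Vertex.toReal_injective {ε : ℝ} (h₀ : 0 < ε) (h₁ : ε < 1 / 2) {n : ℕ} :
    Function.Injective (Vertex.toReal ε : Vertex n → ℝ) := by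
  have key : ∀ a b : ℕ, (a : ℝ) + ε ≠ b - ε := by
    intro a b h
    have h2 : (a : ℝ) < b := by linarith
    have h3 : (b : ℝ) < a + 1 := by linarith
    have h4 : a < b := by exact_mod_cast h2
    have h5 : b < a + 1 := by exact_mod_cast h3
    omega
  rintro (⟨a, _⟩ | ⟨a, _, _⟩) (⟨b, _⟩ | ⟨b, _, _⟩) h <;> simp only [Vertex.toReal] at h
  · have : a = b := by exact_mod_cast add_right_cancel h
    subst this; rfl
  · exact absurd h (key a b)
  · exact absurd h.symm (key b a)
  · have : a = b := by exact_mod_cast sub_left_injective h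
    subst this; rfl

/-- The free groupoid `G` on the objects `0 + ε, k ± ε` and the generators `w_k, l_k^±`. -/
abbrev G (n : ℕ) : Type := Quiver.FreeGroupoid (Vertex n)

/-- The object `k + ε` of `G`. -/
abbrev plus {n : ℕ} (k : ℕ) (h : k ≤ n) : G n := (Quiver.FreeGroupoid.of _).obj (.plus k h)

/-- The object `k - ε` of `G`. -/
abbrev minus {n : ℕ} (k : ℕ) (h₁ : 1 ≤ k) (h : k ≤ n) : G n :=
  (Quiver.FreeGroupoid.of _).obj (.minus k h₁ h)

/-- The base point `P = 0 + ε`. -/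
abbrev basePoint (n : ℕ) : G n := plus 0 (Nat.zero_le n)

/-- The generator `w_k` as a morphism of `G`. -/
def w {n : ℕ} (k : ℕ) (h : k < n) : plus k h.le ⟶ minus (k + 1) (Nat.le_add_left 1 k) h :=
  (Quiver.FreeGroupoid.of (Vertex n)).map (Edge.w k h)

/-- The generator `l_k^+` as a morphism of `G`. -/
def lPlus {n : ℕ} (k : ℕ) (h₁ : 1 ≤ k) (h : k ≤ n) : minus k h₁ h ⟶ plus k h :=
  (Quiver.FreeGroupoid.of (Vertex n)).map (Edge.lPlus k h₁ h)

/-- The generator `l_k^-` as a morphism of `G`. -/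
def lMinus {n : ℕ} (k : ℕ) (h₁ : 1 ≤ k) (h : k ≤ n) : plus k h ⟶ minus k h₁ h :=
  (Quiver.FreeGroupoid.of (Vertex n)).map (Edge.lMinus k h₁ h)

/-- The path `γ_{k+1} = w_0 (l_1^-)⁻¹ w_1 (l_2^-)⁻¹ ⋯ w_k` from `P` to `k + 1 - ε`. -/
def γ {n : ℕ} : (k : ℕ) → (h : k < n) → (basePoint n ⟶ minus (k + 1) (Nat.le_add_left 1 k) h)
  | 0, h => w 0 h
  | k + 1, h =>
      γ k (Nat.lt_of_succ_lt h) ≫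
        Groupoid.inv (lMinus (k + 1) (Nat.le_add_left 1 k) h.le) ≫ w (k + 1) h

/-- The loop `f_{j+1} = γ_{j+1} l_{j+1}^+ l_{j+1}^- γ_{j+1}⁻¹` at `P`. -/
def f {n : ℕ} (j : Fin n) : basePoint n ⟶ basePoint n :=
  γ j j.isLt ≫ lPlus (j + 1) (Nat.le_add_left 1 j) j.isLt ≫
    lMinus (j + 1) (Nat.le_add_left 1 j) j.isLt ≫ Groupoid.inv (γ j j.isLt)

/-! ### Automorphisms preserving the base point -/

/-- The functor underlying an automorphism of a groupoid. -/
def functorOf {C : Type} [Groupoid.{0} C] (F : Aut (Grpd.of C)) : C ⥤ C := F.hom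

/-- `Aut (C, P)`: the group of automorphisms of the groupoid `C` (invertible functors, with the
product `F * F'` given by first `F'`, then `F`) that preserve the object `P`. -/
def pointedAut (C : Type) [Groupoid.{0} C] (P : C) : Subgroup (Aut (Grpd.of C)) where
  carrier := {F | (functorOf F).obj P = P}
  one_mem' := rfl
  mul_mem' {F F'} hF hF' := by
    change (functorOf F).obj P = P at hF
    change (functorOf F').obj P = P at hF'
    change (functorOf F).obj ((functorOf F').obj P) = P
    rw [hF', hF]
  inv_mem' {F} hF := by
    change (functorOf F).obj P = P at hF
    change (functorOf F⁻¹).obj P = P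
    have h : (functorOf F⁻¹).obj ((functorOf F).obj P) = P :=
      congrArg (fun H : C ⥤ C => H.obj P) F.hom_inv_id
    rwa [hF] at h

/-- `F` sends the morphism `a` to the morphism `b` (and so the ends of `a` to those of `b`). -/
def Sends {C : Type} [Groupoid.{0} C] (F : C ⥤ C) {x y x' y' : C} (a : x ⟶ y) (b : x' ⟶ y') :
    Prop :=
  Arrow.mk (F.map a) = Arrow.mk b

/-- The functor `F` acts on the generators of `G` by the formulas of the braid generator `τ_i`,
where `i = m + 1` and `1 ≤ i ≤ n - 1`. -/
structure IsTau {n : ℕ} (m : ℕ) (hm : m + 1 < n) (F : G n ⥤ G n) : Prop where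
  /-- `w_j ↦ w_j` for `j ∉ {i - 1, i, i + 1}` -/
  w_else : ∀ (j : ℕ) (hj : j < n), j ≠ m → j ≠ m + 1 → j ≠ m + 2 → Sends F (w j hj) (w j hj)
  /-- `w_{i-1} ↦ w_{i-1} l_i^+ w_i l_{i+1}^+` -/
  w_pred : Sends F (w m (Nat.lt_of_succ_lt hm))
    (w m (Nat.lt_of_succ_lt hm) ≫ lPlus (m + 1) (by omega) hm.le ≫
      w (m + 1) hm ≫ lPlus (m + 2) (by omega) hm)
  /-- `w_i ↦ w_i⁻¹` -/
  w_self : Sends F (w (m + 1) hm) (Groupoid.inv (w (m + 1) hm))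
  /-- `w_{i+1} ↦ (l_i^-)⁻¹ w_i (l_{i+1}^-)⁻¹ w_{i+1}`, if `w_{i+1}` exists -/
  w_succ : ∀ h : m + 2 < n, Sends F (w (m + 2) h)
    (Groupoid.inv (lMinus (m + 1) (by omega) hm.le) ≫ w (m + 1) hm ≫
      Groupoid.inv (lMinus (m + 2) (by omega) hm) ≫ w (m + 2) h)
  /-- `l_j^+ ↦ l_j^+` for `j ∉ {i, i + 1}` -/
  lPlus_else : ∀ (j : ℕ) (h₁ : 1 ≤ j) (hj : j ≤ n), j ≠ m + 1 → j ≠ m + 2 →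
    Sends F (lPlus j h₁ hj) (lPlus j h₁ hj)
  /-- `l_j^- ↦ l_j^-` for `j ∉ {i, i + 1}` -/
  lMinus_else : ∀ (j : ℕ) (h₁ : 1 ≤ j) (hj : j ≤ n), j ≠ m + 1 → j ≠ m + 2 →
    Sends F (lMinus j h₁ hj) (lMinus j h₁ hj)
  /-- `l_i^+ ↦ l_{i+1}^-` -/
  lPlus_self : Sends F (lPlus (m + 1) (by omega) hm.le) (lMinus (m + 2) (by omega) hm)
  /-- `l_i^- ↦ l_{i+1}^+` -/
  lMinus_self : Sends F (lMinus (m + 1) (by omega) hm.le) (lPlus (m + 2) (by omega) hm)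
  /-- `l_{i+1}^+ ↦ l_i^-` -/
  lPlus_succ : Sends F (lPlus (m + 2) (by omega) hm) (lMinus (m + 1) (by omega) hm.le)
  /-- `l_{i+1}^- ↦ l_i^+` -/
  lMinus_succ : Sends F (lMinus (m + 2) (by omega) hm) (lPlus (m + 1) (by omega) hm.le)

end PlaneGroupoid

/-! The `w_k` and `l_k^-` form a maximal tree. Collapsing it gives every morphism a coordinate in
`F_n` (`coord`), the free generators coming from the `l_k^+`. A morphism is determined by its ends
and its coordinate (`coord_injective`), and `f_j` has coordinate `x_j`, so the vertex group at `P`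
is free on the `f_j`.

In coordinates, a permutation `π` of the vertices, an automorphism `α` of `F_n` and a twist `c`
define an automorphism of `G`, which takes the coordinate `x` of a morphism from `a` to `b` to
`c(a)⁻¹ α(x) c(b)` (`twistFunctor`). The formulas for `τ_i` are of this form, with `α` Artin's
automorphism, and the braid relations are checked component by component. Since `P` is fixed and
`c(P) = 1`, the action on loops at `P` is Artin's action, and injectivity on `G` follows from
faithfulness of that action.

Faithfulness (`artinAction_injective`) is proved by induction on the number of strands. The braids
that keep the first strand in its position are reached by `combHom : F_n ⋊ B_n → B_{n+1}`, and every
braid is such a braid times one of `n + 1` explicit representatives (`exists_eq_combHom_mul`). The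
action on `F_{n+1}` recovers all the data: killing `x_0` detects the representative and the `B_n`
component, and the image of `x_0`, a conjugate `g⁻¹ x_0 g`, yields the `F_n` component as the image
of `g` (`artinAction_combHom`). The latter is well defined because the centralizer of `x_0` dies
with `x_0` (`forget_eq_one_of_conj`). Injectivity of `combHom` is never needed. -/

namespace PlaneGroupoid

/-! ### Generators with natural number indices -/

/-- The braid generator with index `i`, and `1` if there is none. -/
def braidGen (n i : ℕ) : BraidGroup n := if h : i < n - 1 then τ ⟨i, h⟩ else 1

/-- The free generator with index `k`, and `1` if there is none. -/
def freeGen (n k : ℕ) : FreeGroup (Fin n) := if h : k < n then FreeGroup.of ⟨k, h⟩ else 1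

theorem braidGen_val {n : ℕ} (i : Fin (n - 1)) : braidGen n i = τ i := by
  simp [braidGen]

theorem freeGen_val {n : ℕ} (k : Fin n) : freeGen n k = FreeGroup.of k := by
  simp [freeGen]

theorem braidGen_comm (n : ℕ) {i j : ℕ} (h : i + 2 ≤ j) :
    braidGen n i * braidGen n j = braidGen n j * braidGen n i := by
  unfold braidGen
  split_ifs with h₁ h₂
  · exact PresentedGroup.mk_eq_mk_of_mul_inv_mem (BraidRelator.far ⟨i, h₁⟩ ⟨j, h₂⟩ h)
  all_goals simp

theorem braidGen_braid {n i : ℕ} (h : i + 2 < n) :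
    braidGen n i * braidGen n (i + 1) * braidGen n i =
      braidGen n (i + 1) * braidGen n i * braidGen n (i + 1) := by
  unfold braidGen
  rw [dif_pos (by omega), dif_pos (by omega)]
  exact PresentedGroup.mk_eq_mk_of_mul_inv_mem
    (BraidRelator.near ⟨i, by omega⟩ ⟨i + 1, by omega⟩ rfl)

theorem artinAction_τ {n : ℕ} (i : Fin (n - 1)) : artinAction n (τ i) = artinAut i :=
  PresentedGroup.toGroup.of _

theorem artinAction_braidGen_self {n i : ℕ} (h : i + 1 < n) :
    artinAction n (braidGen n i) (freeGen n i) =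
      freeGen n i * freeGen n (i + 1) * (freeGen n i)⁻¹ := by
  have h' : i < n - 1 := by omega
  have h₀ : i < n := by omega
  simp only [braidGen, h', freeGen, h, h₀, dif_pos, artinAction_τ]
  exact artinHom_lo ⟨i, h'⟩

theorem artinAction_braidGen_succ {n i : ℕ} (h : i + 1 < n) :
    artinAction n (braidGen n i) (freeGen n (i + 1)) = freeGen n i := by
  have h' : i < n - 1 := by omega
  have h₀ : i < n := by omega
  simp only [braidGen, h', freeGen, h, h₀, dif_pos, artinAction_τ]
  exact artinHom_hi ⟨i, h'⟩

theorem artinAction_braidGen_else {n i k : ℕ} (h : k ≠ i) (h' : k ≠ i + 1) :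
    artinAction n (braidGen n i) (freeGen n k) = freeGen n k := by
  unfold braidGen freeGen
  split_ifs with h₁ h₂
  · rw [artinAction_τ]
    exact artinHom_else _ _ (by simpa [lo] using h) (by simpa [hi] using h')
  all_goals simp

theorem braidGroup_mem {n : ℕ} (H : Subgroup (BraidGroup n)) (h : ∀ i, i + 1 < n → braidGen n i ∈ H)
    (β : BraidGroup n) : β ∈ H := by
  refine PresentedGroup.generated_by _ H (fun i => ?_) β
  have := h i (by omega)
  rwa [braidGen_val] at this

theorem freeHom_ext {n : ℕ} {M : Type*} [Group M] {φ ψ : FreeGroup (Fin n) →* M}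
    (h : ∀ k < n, φ (freeGen n k) = ψ (freeGen n k)) : φ = ψ := by
  ext k
  have := h k k.isLt
  rwa [freeGen_val] at this

theorem freeLift_freeGen {n k : ℕ} {M : Type*} [Group M] (u : ℕ → M) (h : k < n) :
    FreeGroup.lift (fun j : Fin n => u j) (freeGen n k) = u k := by
  simp [freeGen, h]

theorem braidHom_apply_eq {n : ℕ} {M : Type*} [Group M] {φ ψ : BraidGroup n →* M}
    (h : ∀ i, i + 1 < n → φ (braidGen n i) = ψ (braidGen n i)) : φ = ψ := by
  refine PresentedGroup.ext fun i => ?_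
  have := h i (by omega)
  rwa [braidGen_val] at this

/-- A homomorphism from the braid group, given by elements that satisfy the braid relations. -/
def braidLift {n : ℕ} {M : Type*} [Group M] (u : ℕ → M)
    (h₁ : ∀ i j, i + 2 ≤ j → j + 1 < n → u i * u j = u j * u i)
    (h₂ : ∀ i, i + 2 < n → u i * u (i + 1) * u i = u (i + 1) * u i * u (i + 1)) :
    BraidGroup n →* M :=
  PresentedGroup.toGroup (f := fun i : Fin (n - 1) => u i) <| by
    rintro r (⟨i, j, h⟩ | ⟨i, j, h⟩)
    · simp only [map_mul, map_inv, FreeGroup.lift_apply_of, h₁ i j h (by omega), mul_inv_cancel]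
    · simp only [map_mul, map_inv, FreeGroup.lift_apply_of, ← h, h₂ i (by omega), mul_inv_cancel]

theorem braidLift_braidGen {n i : ℕ} {M : Type*} [Group M] (u : ℕ → M)
    (h₁ : ∀ i j, i + 2 ≤ j → j + 1 < n → u i * u j = u j * u i)
    (h₂ : ∀ i, i + 2 < n → u i * u (i + 1) * u i = u (i + 1) * u i * u (i + 1)) (hi : i + 1 < n) :
    braidLift u h₁ h₂ (braidGen n i) = u i := by
  have h' : i < n - 1 := by omega
  simp only [braidGen, h', dif_pos]
  exact PresentedGroup.toGroup.of (f := fun i : Fin (n - 1) => u i) _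

/-! ### Removing the first strand -/

/-- The inclusion of `B_n` in `B_{n+1}` as the braids on the last `n` strands. -/
def braidShift (n : ℕ) : BraidGroup n →* BraidGroup (n + 1) :=
  braidLift (fun i => braidGen (n + 1) (i + 1)) (fun _ _ h _ => braidGen_comm _ (by omega))
    (fun _ h => braidGen_braid (by omega))

theorem braidShift_braidGen {n i : ℕ} (h : i + 1 < n) :
    braidShift n (braidGen n i) = braidGen (n + 1) (i + 1) :=
  braidLift_braidGen _ _ _ h

/-- The product of the first `k` braid generators. -/
def braidProd (n : ℕ) : ℕ → BraidGroup n
  | 0 => 1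
  | k + 1 => braidProd n k * braidGen n k

theorem braidProd_mul_of_lt (n : ℕ) {k i : ℕ} (h : k < i) :
    braidProd n k * braidGen n i = braidGen n i * braidProd n k := by
  induction k with
  | zero => simp [braidProd]
  | succ k ih =>
    rw [braidProd, mul_assoc, braidGen_comm n h, ← mul_assoc, ih (by omega), mul_assoc]

/-- The braid relation moves `σ_i` through `σ_i σ_{i+1}`, where it emerges as `σ_{i+1}`; all other
factors of the product commute with what passes them. -/
theorem braidProd_mul_of_gt {n k i : ℕ} (h : i + 2 ≤ k) (hk : k < n) :
    braidProd n k * braidGen n i = braidGen n (i + 1) * braidProd n k := by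
  induction k, h using Nat.le_induction with
  | base =>
    rw [braidProd, braidProd, mul_assoc, mul_assoc, ← mul_assoc (braidGen n i), braidGen_braid hk,
      ← mul_assoc, ← mul_assoc, braidProd_mul_of_lt n (Nat.lt_succ_self i)]
    simp only [mul_assoc]
  | succ k h ih =>
    rw [braidProd, mul_assoc, ← braidGen_comm n h, ← mul_assoc, ih (by omega), mul_assoc]

/-- The pure braid in which the first strand runs once around strand `k + 1`. -/
def pureBraid (n k : ℕ) : BraidGroup n :=
  braidProd n k * (braidGen n k * braidGen n k)⁻¹ * (braidProd n k)⁻¹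

theorem conj_pureBraid_else {n i k : ℕ} (hk : k + 1 < n) (h : k ≠ i) (h' : k ≠ i + 1) :
    braidGen n (i + 1) * pureBraid n k * (braidGen n (i + 1))⁻¹ = pureBraid n k := by
  rw [mul_inv_eq_iff_eq_mul, pureBraid]
  rcases lt_or_gt_of_ne h with h₁ | h₁
  · have e₁ : Commute (braidGen n (i + 1)) (braidProd n k) :=
      (braidProd_mul_of_lt n (by omega)).symm
    have e₂ : Commute (braidGen n (i + 1)) (braidGen n k) :=
      (braidGen_comm n (by omega)).symm
    exact (e₁.mul_right (e₂.mul_right e₂).inv_right).mul_right e₁.inv_right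
  · have e₁ := braidProd_mul_of_gt (show i + 2 ≤ k by omega) (by omega : k < n)
    have e₂ : Commute (braidGen n i) (braidGen n k) := braidGen_comm n (by omega)
    have e₃ := (e₂.mul_right e₂).inv_right.eq
    -- For `k > i + 1` the generator `σ_{i+1}` is the conjugate of `σ_i` by the product inside
    -- `pureBraid n k`, so the claim reduces to `σ_i` commuting with `σ_k`.
    have e₄ : braidGen n (i + 1) = braidProd n k * braidGen n i * (braidProd n k)⁻¹ := by
      rw [e₁, mul_inv_cancel_right]
    rw [e₄]
    calc _ = braidProd n k * (braidGen n i * (braidGen n k * braidGen n k)⁻¹) *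
          (braidProd n k)⁻¹ := by group
      _ = _ := by rw [e₃]; group

theorem conj_pureBraid_succ {n i : ℕ} (h : i + 2 < n) :
    braidGen n (i + 1) * pureBraid n (i + 1) * (braidGen n (i + 1))⁻¹ = pureBraid n i := by
  have e₁ : Commute (braidGen n (i + 1)) (braidProd n i) :=
    (braidProd_mul_of_lt n (by omega)).symm
  have e₂ := braidGen_braid h
  rw [pureBraid, pureBraid, braidProd]
  set a := braidGen n i
  set b := braidGen n (i + 1)
  set p := braidProd n i
  have e₃ : b * a * b * (b * a)⁻¹ = a := by rw [← e₂]; group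
  calc _ = (b * p) * (a * (b * b)⁻¹ * a⁻¹) * (b * p)⁻¹ := by group
    _ = p * (b * a * b * (b * a)⁻¹ * (b * a * b * (b * a)⁻¹))⁻¹ * p⁻¹ := by rw [e₁.eq]; group
    _ = _ := by rw [e₃]

theorem conj_pureBraid_self {n i : ℕ} (h : i + 2 < n) :
    braidGen n (i + 1) * pureBraid n i * (braidGen n (i + 1))⁻¹ =
      pureBraid n i * pureBraid n (i + 1) * (pureBraid n i)⁻¹ := by
  have e₁ : Commute (braidGen n (i + 1)) (braidProd n i) :=
    (braidProd_mul_of_lt n (by omega)).symm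
  have e₂ := braidGen_braid h
  rw [pureBraid, pureBraid, braidProd]
  set a := braidGen n i
  set b := braidGen n (i + 1)
  set p := braidProd n i
  have e₃ : b * a * b⁻¹ = a⁻¹ * b * a := by
    rw [mul_inv_eq_iff_eq_mul, mul_assoc, mul_assoc, eq_inv_mul_iff_mul_eq, ← mul_assoc, e₂,
      mul_assoc]
  calc _ = (b * p) * (a * a)⁻¹ * (b * p)⁻¹ := by group
    _ = p * (b * a * b⁻¹ * (b * a * b⁻¹))⁻¹ * p⁻¹ := by rw [e₁.eq]; group
    _ = _ := by rw [e₃]; group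

/-- The homomorphism from `F_n` that sends the free generators to the braids `pureBraid`. -/
def pureHom (n : ℕ) : FreeGroup (Fin n) →* BraidGroup (n + 1) :=
  FreeGroup.lift fun k => pureBraid (n + 1) k

theorem pureHom_freeGen {n k : ℕ} (h : k < n) :
    pureHom n (freeGen n k) = pureBraid (n + 1) k :=
  freeLift_freeGen _ h

/-- This is the compatibility that a homomorphism out of the semidirect product requires. It is
closed under products and inverses in `β`, and on generators it is the three `conj_pureBraid`
identities, which have the shape of Artin's formulas. -/
theorem pureHom_artinAction (n : ℕ) (β : BraidGroup n) :
    (pureHom n).comp (artinAction n β).toMonoidHom =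
      (MulAut.conj (braidShift n β)).toMonoidHom.comp (pureHom n) := by
  suffices h : ∀ v, pureHom n (artinAction n β v) =
      braidShift n β * pureHom n v * (braidShift n β)⁻¹ from MonoidHom.ext h
  let H : Subgroup (BraidGroup n) :=
    { carrier := {β | ∀ v, pureHom n (artinAction n β v) =
        braidShift n β * pureHom n v * (braidShift n β)⁻¹}
      one_mem' := fun v => by simp
      mul_mem' := fun {a b} ha hb v => by
        rw [map_mul, MulAut.mul_apply, ha, hb, map_mul]; group
      inv_mem' := fun {a} ha v => by
        have := ha (artinAction n a⁻¹ v)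
        rw [← MulAut.mul_apply, ← map_mul, mul_inv_cancel, map_one, MulAut.one_apply] at this
        simp only [this, map_inv, mul_assoc, inv_mul_cancel_left, inv_inv, inv_mul_cancel, mul_one] }
  refine braidGroup_mem H (fun i hi => ?_) β
  suffices h : (pureHom n).comp (artinAction n (braidGen n i)).toMonoidHom =
      (MulAut.conj (braidShift n (braidGen n i))).toMonoidHom.comp (pureHom n) from
    fun v => DFunLike.congr_fun h v
  refine freeHom_ext fun k hk => ?_
  simp only [MonoidHom.comp_apply, MulEquiv.toMonoidHom_eq_coe, MonoidHom.coe_coe,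
    MulAut.conj_apply, braidShift_braidGen hi, pureHom_freeGen hk]
  by_cases h₁ : k = i
  · subst h₁
    rw [artinAction_braidGen_self hi, conj_pureBraid_self (by omega)]
    simp [pureHom_freeGen, hk, hi]
  by_cases h₂ : k = i + 1
  · subst h₂
    rw [artinAction_braidGen_succ hi, conj_pureBraid_succ (by omega), pureHom_freeGen (by omega)]
  · rw [artinAction_braidGen_else h₁ h₂, pureHom_freeGen hk,
      conj_pureBraid_else (by omega) h₁ h₂]

/-- The homomorphism `F_n ⋊ B_n → B_{n+1}` onto the braids that fix the position of the first
strand. -/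
def combHom (n : ℕ) : FreeGroup (Fin n) ⋊[artinAction n] BraidGroup n →* BraidGroup (n + 1) :=
  SemidirectProduct.lift (pureHom n) (braidShift n) (pureHom_artinAction n)

theorem braidGen_mem_range_combHom {n i : ℕ} (h : i + 1 < n) :
    braidGen (n + 1) (i + 1) ∈ (combHom n).range :=
  ⟨SemidirectProduct.inr (braidGen n i), by
    rw [combHom, SemidirectProduct.lift_inr, braidShift_braidGen h]⟩

theorem pureBraid_mem_range_combHom {n k : ℕ} (h : k < n) :
    pureBraid (n + 1) k ∈ (combHom n).range :=
  ⟨SemidirectProduct.inl (freeGen n k), by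
    rw [combHom, SemidirectProduct.lift_inl, pureHom_freeGen h]⟩

/-- The products `braidProd (n + 1) k` are coset representatives. -/
theorem exists_eq_combHom_mul (n : ℕ) (β : BraidGroup (n + 1)) :
    ∃ k ≤ n, ∃ e, β = combHom n e * braidProd (n + 1) k := by
  -- The union of the cosets is stable under right multiplication by generators and their inverses.
  -- The representative changes only when `i = k` or `i = k - 1`; the full twist that may be left
  -- over is a `pureBraid` or its inverse.
  have key : ∀ k ≤ n, ∀ i < n, ∃ k' ≤ n, ∃ d ∈ (combHom n).range,
      braidProd (n + 1) k * braidGen (n + 1) i = d * braidProd (n + 1) k' ∧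
      ∃ k' ≤ n, ∃ d ∈ (combHom n).range,
        braidProd (n + 1) k * (braidGen (n + 1) i)⁻¹ = d * braidProd (n + 1) k' := by
    intro k hk i hi
    rcases lt_trichotomy k i with h | rfl | h
    · obtain ⟨j, rfl⟩ : ∃ j, i = j + 1 := ⟨i - 1, by omega⟩
      have e := braidProd_mul_of_lt (n + 1) h
      have m := braidGen_mem_range_combHom hi
      refine ⟨k, hk, _, m, e, k, hk, _, inv_mem m, ?_⟩
      rw [mul_inv_eq_iff_eq_mul, mul_assoc, e, inv_mul_cancel_left]
    · refine ⟨k + 1, hi, 1, one_mem _, by rw [one_mul, braidProd], k + 1, hi, _,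
        pureBraid_mem_range_combHom hi, ?_⟩
      rw [pureBraid, braidProd]
      group
    · obtain ⟨j, rfl⟩ : ∃ j, k = j + 1 := ⟨k - 1, by omega⟩
      rcases Nat.lt_succ_iff_lt_or_eq.1 h with h | rfl
      · have e := braidProd_mul_of_gt (show i + 2 ≤ j + 1 by omega) (show j + 1 < n + 1 by omega)
        have m := braidGen_mem_range_combHom (show i + 1 < n by omega)
        refine ⟨j + 1, hk, _, m, e, j + 1, hk, _, inv_mem m, ?_⟩
        rw [mul_inv_eq_iff_eq_mul, mul_assoc, e, inv_mul_cancel_left]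
      · refine ⟨i, hi.le, _, inv_mem (pureBraid_mem_range_combHom hi), ?_, i, hi.le, 1,
          one_mem _, ?_⟩
        · rw [pureBraid, braidProd]
          simp [mul_assoc]
        · rw [braidProd]
          group
  have hβ : β ∈ Subgroup.closure {g | ∃ i < n, g = braidGen (n + 1) i} := by
    refine braidGroup_mem _ (fun i hi => ?_) β
    exact Subgroup.subset_closure ⟨i, by omega, rfl⟩
  induction hβ using Subgroup.closure_induction_right with
  | one => exact ⟨0, Nat.zero_le n, 1, by simp [braidProd]⟩
  | mul_right x y _ hy ih =>
    obtain ⟨i, hi, rfl⟩ := hy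
    obtain ⟨k, hk, e, rfl⟩ := ih
    obtain ⟨k', hk', _, ⟨d, rfl⟩, h, -⟩ := key k hk i hi
    exact ⟨k', hk', e * d, by rw [mul_assoc, h, map_mul, mul_assoc]⟩
  | mul_inv_cancel x y _ hy ih =>
    obtain ⟨i, hi, rfl⟩ := hy
    obtain ⟨k, hk, e, rfl⟩ := ih
    obtain ⟨-, -, -, -, -, k', hk', _, ⟨d, rfl⟩, h⟩ := key k hk i hi
    exact ⟨k', hk', e * d, by rw [mul_assoc, h, map_mul, mul_assoc]⟩

/-! ### Artin's action is faithful -/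

/-- The homomorphism `F_{n+1} → F_n` that kills the generator with index `k` and renumbers
the others. -/
def forget (n k : ℕ) : FreeGroup (Fin (n + 1)) →* FreeGroup (Fin n) :=
  FreeGroup.lift fun j =>
    if (j : ℕ) < k then freeGen n j else if (j : ℕ) = k then 1 else freeGen n (j - 1)

theorem forget_freeGen {n k j : ℕ} (h : j ≤ n) : forget n k (freeGen (n + 1) j) =
    if j < k then freeGen n j else if j = k then 1 else freeGen n (j - 1) :=
  freeLift_freeGen (fun j => if j < k then freeGen n j else if j = k then 1 else freeGen n (j - 1))
    (Nat.lt_succ_of_le h)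

theorem forget_zero_freeGen_zero (n : ℕ) : forget n 0 (freeGen (n + 1) 0) = 1 := by
  simp [forget_freeGen]

theorem forget_zero_freeGen_succ {n j : ℕ} (h : j < n) :
    forget n 0 (freeGen (n + 1) (j + 1)) = freeGen n j := by
  simp [forget_freeGen, Nat.succ_le_of_lt h]

theorem forget_zero_surjective (n : ℕ) : Function.Surjective (forget n 0) := by
  intro y
  have : y ∈ (forget n 0).range := by
    induction y with
    | C1 => exact one_mem _
    | of j => exact ⟨_, (forget_zero_freeGen_succ j.isLt).trans (freeGen_val j)⟩
    | inv_of j h => exact inv_mem h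
    | mul a b ha hb => exact mul_mem ha hb
  exact this

/-- If `g` commutes with the first free generator, then it is killed with this generator. -/
theorem forget_eq_one_of_conj {n : ℕ} {g : FreeGroup (Fin (n + 1))}
    (h : g⁻¹ * freeGen (n + 1) 0 * g = freeGen (n + 1) 0) : forget n 0 g = 1 := by
  classical
  let F := FreeGroup (Fin n)
  -- `F_{n+1}` is made to act on two copies of `F_n`: `x_0` exchanges the two copies of `1`, and the
  -- other generators translate both copies. On the first component, `g` then acts as left
  -- multiplication by its image under `forget n 0`.
  let s : Equiv.Perm (F × Bool) := Equiv.swap (1, true) (1, false)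
  let T : F →* Equiv.Perm (F × Bool) :=
    { toFun := fun a => (Equiv.mulLeft a).prodCongr (Equiv.refl Bool)
      map_one' := by ext x <;> simp
      map_mul' := fun a b => by ext x <;> simp [mul_assoc] }
  let R : FreeGroup (Fin (n + 1)) →* Equiv.Perm (F × Bool) :=
    FreeGroup.lift fun j => if (j : ℕ) = 0 then s else T (freeGen n (j - 1))
  have hR0 : R (freeGen (n + 1) 0) = s :=
    freeLift_freeGen (fun j : ℕ => if j = 0 then s else T (freeGen n (j - 1))) (Nat.succ_pos n)
  have hs : ∀ x, (s x).1 = x.1 := by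
    intro x
    by_cases h₁ : x = (1, true)
    · simp [h₁, s]
    by_cases h₂ : x = (1, false)
    · simp [h₂, s]
    · simp [s, Equiv.swap_apply_of_ne_of_ne h₁ h₂]
  have hR : ∀ g x, (R g x).1 = forget n 0 g * x.1 := by
    intro g
    induction g with
    | C1 => simp
    | of j =>
      intro x
      by_cases hj : (j : ℕ) = 0
      · obtain rfl : j = 0 := Fin.ext hj
        simp [R, forget, hs]
      · have hj' : j ≠ 0 := fun h => hj (by simp [h])
        simp [R, forget, hj', T]
    | inv_of j ih =>
      intro x
      have := ih ((R (FreeGroup.of j))⁻¹ x)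
      rw [← Equiv.Perm.mul_apply, mul_inv_cancel, Equiv.Perm.one_apply] at this
      rw [this, map_inv, map_inv, inv_mul_cancel_left]
    | mul a b ha hb =>
      intro x
      rw [map_mul, map_mul, Equiv.Perm.mul_apply, ha, hb, mul_assoc]
  have h' : freeGen (n + 1) 0 * g = g * freeGen (n + 1) 0 := by
    rw [mul_assoc, inv_mul_eq_iff_eq_mul] at h
    exact h
  by_contra hg
  have e := congrArg (fun p => R p (1, true)) h'
  simp only [map_mul, Equiv.Perm.mul_apply, hR0] at e
  -- If the image of `g` is not `1`, then `g` moves `(1, true)` to a point that `s` fixes. As `g`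
  -- commutes with `x_0`, it would send `(1, true)` and `(1, false)` to the same point.
  have h₁ : (R g (1, true)).1 ≠ 1 := by rw [hR, mul_one]; exact hg
  have h₂ : s (R g (1, true)) = R g (1, true) :=
    Equiv.swap_apply_of_ne_of_ne (fun hh => h₁ (by rw [hh])) (fun hh => h₁ (by rw [hh]))
  have h₃ : s (1, true) = (1, false) := Equiv.swap_apply_left _ _
  rw [h₂, h₃] at e
  simpa using (R g).injective e

/-- Once `x_k` is killed, the conjugation in Artin's formula disappears and only the exchange of the
indices `k` and `k + 1` remains. The same holds for the inverse generator. -/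
theorem forget_artinAction_braidGen {n k : ℕ} (h : k < n) (y : FreeGroup (Fin (n + 1))) :
    forget n k (artinAction (n + 1) (braidGen (n + 1) k) y) = forget n (k + 1) y := by
  suffices e : (forget n k).comp (artinAction (n + 1) (braidGen (n + 1) k)).toMonoidHom =
    forget n (k + 1) from DFunLike.congr_fun e y
  refine freeHom_ext fun j hj => ?_
  simp only [MonoidHom.comp_apply, MulEquiv.toMonoidHom_eq_coe, MonoidHom.coe_coe]
  by_cases h₁ : j = k
  · subst h₁
    rw [artinAction_braidGen_self (by omega)]
    simp [forget_freeGen, h.le, Nat.succ_le_of_lt h]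
  by_cases h₂ : j = k + 1
  · subst h₂
    rw [artinAction_braidGen_succ (by omega)]
    simp [forget_freeGen, h.le, Nat.succ_le_of_lt h]
  · rw [artinAction_braidGen_else h₁ h₂, forget_freeGen (by omega), forget_freeGen (by omega)]
    split_ifs <;> first | rfl | omega

theorem forget_artinAction_braidGen_inv {n k : ℕ} (h : k < n) (y : FreeGroup (Fin (n + 1))) :
    forget n k ((artinAction (n + 1) (braidGen (n + 1) k))⁻¹ y) = forget n (k + 1) y := by
  obtain ⟨z, rfl⟩ := (artinAction (n + 1) (braidGen (n + 1) k)).surjective y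
  rw [MulAut.inv_apply_self]
  suffices e : (forget n (k + 1)).comp (artinAction (n + 1) (braidGen (n + 1) k)).toMonoidHom =
    forget n k from (DFunLike.congr_fun e z).symm
  refine freeHom_ext fun j hj => ?_
  simp only [MonoidHom.comp_apply, MulEquiv.toMonoidHom_eq_coe, MonoidHom.coe_coe]
  by_cases h₁ : j = k
  · subst h₁
    rw [artinAction_braidGen_self (by omega)]
    simp [forget_freeGen, h.le, Nat.succ_le_of_lt h]
  by_cases h₂ : j = k + 1
  · subst h₂
    rw [artinAction_braidGen_succ (by omega)]
    simp [forget_freeGen, h.le, Nat.succ_le_of_lt h]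
  · rw [artinAction_braidGen_else h₁ h₂, forget_freeGen (by omega), forget_freeGen (by omega)]
    split_ifs <;> first | rfl | omega

theorem forget_artinAction_braidProd {n k : ℕ} (h : k ≤ n) (y : FreeGroup (Fin (n + 1))) :
    forget n 0 (artinAction (n + 1) (braidProd (n + 1) k) y) = forget n k y := by
  induction k generalizing y with
  | zero => simp [braidProd]
  | succ k ih =>
    rw [braidProd, map_mul, MulAut.mul_apply, ih (by omega), forget_artinAction_braidGen h]

theorem artinAction_braidProd_of_lt {n k j : ℕ} (h : k < j) :
    artinAction n (braidProd n k) (freeGen n j) = freeGen n j := by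
  induction k with
  | zero => simp [braidProd]
  | succ k ih =>
    rw [braidProd, map_mul, MulAut.mul_apply, artinAction_braidGen_else (by omega) (by omega),
      ih (by omega)]

theorem artinAction_braidProd_self {n k : ℕ} (h : k < n) :
    artinAction n (braidProd n k) (freeGen n k) = freeGen n 0 := by
  induction k with
  | zero => simp [braidProd]
  | succ k ih =>
    rw [braidProd, map_mul, MulAut.mul_apply, artinAction_braidGen_succ h, ih (by omega)]

/-- When the first strand is forgotten, a braid in which only this strand moves becomes trivial.
Formally, `σ_k` and its inverse agree after `forget n k`, so the full twist cancels. -/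
theorem forget_artinAction_pureBraid {n k : ℕ} (h : k < n) (y : FreeGroup (Fin (n + 1))) :
    forget n 0 (artinAction (n + 1) (pureBraid (n + 1) k) y) = forget n 0 y := by
  have e₁ := forget_artinAction_braidProd h.le
    ((artinAction (n + 1) (braidProd (n + 1) k))⁻¹ y)
  rw [MulAut.apply_inv_self] at e₁
  rw [pureBraid, map_mul, map_mul, map_inv, map_inv, map_mul, mul_inv_rev, MulAut.mul_apply,
    MulAut.mul_apply, MulAut.mul_apply, forget_artinAction_braidProd h.le,
    forget_artinAction_braidGen_inv h, ← forget_artinAction_braidGen h,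
    MulAut.apply_inv_self, e₁]

theorem artinAction_pureBraid {n k : ℕ} (h : k < n) :
    artinAction (n + 1) (pureBraid (n + 1) k) (freeGen (n + 1) 0) =
      (freeGen (n + 1) (k + 1))⁻¹ * freeGen (n + 1) 0 * freeGen (n + 1) (k + 1) := by
  have h' : k + 1 < n + 1 := Nat.succ_lt_succ h
  -- Writing `x_0` as the image of `x_k` under `braidProd` cancels the right-hand factor of
  -- `pureBraid`.
  rw [pureBraid, ← artinAction_braidProd_self (show k < n + 1 by omega), ← MulAut.mul_apply,
    ← map_mul, inv_mul_cancel_right, map_mul, MulAut.mul_apply]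
  have e : artinAction (n + 1) (braidGen (n + 1) k * braidGen (n + 1) k)⁻¹ (freeGen (n + 1) k) =
      (freeGen (n + 1) (k + 1))⁻¹ * freeGen (n + 1) k * freeGen (n + 1) (k + 1) := by
    rw [map_inv, MulAut.inv_apply, MulEquiv.symm_apply_eq]
    simp [artinAction_braidGen_self h', artinAction_braidGen_succ h', mul_assoc]
  rw [e]
  simp only [map_mul, map_inv, artinAction_braidProd_of_lt (Nat.lt_succ_self k)]

/-- Both components of `e` are read off from the action on `F_{n+1}`. The conjugators multiply by
the cocycle rule that defines the product in the semidirect product, so the property passes to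
products and inverses and needs checking only on the two factors. -/
theorem artinAction_combHom (n : ℕ) (e : FreeGroup (Fin n) ⋊[artinAction n] BraidGroup n) :
    (∃ g, artinAction (n + 1) (combHom n e) (freeGen (n + 1) 0) = g⁻¹ * freeGen (n + 1) 0 * g ∧
      forget n 0 g = e.left) ∧
    ∀ y, forget n 0 (artinAction (n + 1) (combHom n e) y) =
      artinAction n e.right (forget n 0 y) := by
  let K : Subgroup (FreeGroup (Fin n) ⋊[artinAction n] BraidGroup n) :=
    { carrier := {e | (∃ g, artinAction (n + 1) (combHom n e) (freeGen (n + 1) 0) =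
          g⁻¹ * freeGen (n + 1) 0 * g ∧ forget n 0 g = e.left) ∧
        ∀ y, forget n 0 (artinAction (n + 1) (combHom n e) y) =
          artinAction n e.right (forget n 0 y)}
      one_mem' := ⟨⟨1, by simp⟩, by simp⟩
      mul_mem' := by
        rintro a b ⟨⟨g, hg, hg'⟩, ha⟩ ⟨⟨k, hk, hk'⟩, hb⟩
        refine ⟨⟨g * artinAction (n + 1) (combHom n a) k, ?_, ?_⟩, fun y => ?_⟩
        · rw [map_mul, map_mul, MulAut.mul_apply, hk, map_mul, map_mul, hg, map_inv]
          group
        · rw [map_mul, hg', ha, hk', SemidirectProduct.mul_left]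
        · rw [map_mul, map_mul, MulAut.mul_apply, ha, hb, SemidirectProduct.mul_right, map_mul,
            MulAut.mul_apply]
      inv_mem' := by
        rintro a ⟨⟨g, hg, hg'⟩, ha⟩
        have ha' : ∀ y, forget n 0 ((artinAction (n + 1) (combHom n a))⁻¹ y) =
            (artinAction n a.right)⁻¹ (forget n 0 y) := by
          intro y
          obtain ⟨z, rfl⟩ := (artinAction (n + 1) (combHom n a)).surjective y
          rw [MulAut.inv_apply_self, ha, MulAut.inv_apply_self]
        refine ⟨⟨(artinAction (n + 1) (combHom n a))⁻¹ g⁻¹, ?_, ?_⟩, fun y => ?_⟩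
        · rw [map_inv (combHom n), map_inv (artinAction (n + 1))]
          apply (artinAction (n + 1) (combHom n a)).injective
          simp only [map_mul, map_inv, MulAut.apply_inv_self, hg]
          group
        · rw [ha', map_inv, hg', SemidirectProduct.inv_left, map_inv (artinAction n)]
        · rw [map_inv, map_inv, ha', SemidirectProduct.inv_right, map_inv] }
  have hl : ∀ v, SemidirectProduct.inl v ∈ K := by
    intro v
    change v ∈ K.comap SemidirectProduct.inl
    induction v with
    | C1 => exact one_mem _
    | of j =>
      have e : combHom n (SemidirectProduct.inl (FreeGroup.of j)) = pureBraid (n + 1) j := by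
        rw [combHom, SemidirectProduct.lift_inl, ← freeGen_val, pureHom_freeGen j.isLt]
      refine ⟨⟨freeGen (n + 1) (j + 1), ?_, ?_⟩, fun y => ?_⟩
      · rw [e, artinAction_pureBraid j.isLt]
      · rw [forget_zero_freeGen_succ j.isLt, freeGen_val, SemidirectProduct.left_inl]
      · rw [e, forget_artinAction_pureBraid j.isLt]
        simp
    | inv_of j h => exact inv_mem h
    | mul a b ha hb => exact mul_mem ha hb
  have hr : ∀ b, SemidirectProduct.inr b ∈ K := by
    refine fun b => braidGroup_mem (K.comap SemidirectProduct.inr) (fun i hi => ?_) b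
    have e : combHom n (SemidirectProduct.inr (braidGen n i)) = braidGen (n + 1) (i + 1) := by
      rw [combHom, SemidirectProduct.lift_inr, braidShift_braidGen hi]
    refine ⟨⟨1, ?_, ?_⟩, fun y => ?_⟩
    · rw [e, artinAction_braidGen_else (by omega) (by omega)]
      simp
    · simp
    · rw [e, SemidirectProduct.right_inr]
      suffices e' : (forget n 0).comp
          (artinAction (n + 1) (braidGen (n + 1) (i + 1))).toMonoidHom =
          (artinAction n (braidGen n i)).toMonoidHom.comp (forget n 0) from
        DFunLike.congr_fun e' y
      refine freeHom_ext fun j hj => ?_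
      simp only [MonoidHom.comp_apply, MulEquiv.toMonoidHom_eq_coe, MonoidHom.coe_coe]
      rcases j with _ | j
      · rw [artinAction_braidGen_else (by omega) (by omega), forget_zero_freeGen_zero, map_one]
      rw [forget_zero_freeGen_succ (by omega)]
      by_cases h₁ : j = i
      · subst h₁
        rw [artinAction_braidGen_self (by omega), artinAction_braidGen_self hi]
        simp [forget_zero_freeGen_succ, hi, (by omega : j < n)]
      by_cases h₂ : j = i + 1
      · subst h₂
        rw [artinAction_braidGen_succ (by omega), artinAction_braidGen_succ hi,
          forget_zero_freeGen_succ (by omega)]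
      · rw [artinAction_braidGen_else (by omega) (by omega), artinAction_braidGen_else h₁ h₂,
          forget_zero_freeGen_succ (by omega)]
  have := mul_mem (hl e.left) (hr e.right)
  rwa [SemidirectProduct.inl_left_mul_inr_right] at this

theorem artinAction_injective (n : ℕ) : Function.Injective (artinAction n) := by
  induction n with
  | zero =>
    have h : ∀ β : BraidGroup 0, β = 1 := fun β => Subgroup.mem_bot.1 <|
      braidGroup_mem ⊥ (fun i hi => absurd hi (by omega)) β
    intro a b _
    rw [h a, h b]
  | succ n ih =>
    rw [injective_iff_map_eq_one]
    intro β hβ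
    obtain ⟨k, hk, e, rfl⟩ := exists_eq_combHom_mul n β
    obtain ⟨⟨g, hg, hg'⟩, he⟩ := artinAction_combHom n e
    rcases k with _ | k
    · rw [braidProd, mul_one] at hβ ⊢
      rw [hβ, MulAut.one_apply] at hg
      have hl : e.left = 1 := by rw [← hg', forget_eq_one_of_conj hg.symm]
      have hr : e.right = 1 := by
        apply (injective_iff_map_eq_one _).1 ih
        ext1 y
        obtain ⟨z, rfl⟩ := forget_zero_surjective n y
        rw [← he, hβ]
        rfl
      rw [← SemidirectProduct.inl_left_mul_inr_right e, hl, hr]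
      simp
    -- For a representative with `k + 1 > 0`, the image of `x_0` survives `forget n 0`, whereas
    -- `x_0` itself is killed; so the braid does not act trivially.
    · exfalso
      have h := he (artinAction (n + 1) (braidProd (n + 1) (k + 1)) (freeGen (n + 1) 0))
      rw [← MulAut.mul_apply, ← map_mul, hβ, MulAut.one_apply, forget_zero_freeGen_zero,
        forget_artinAction_braidProd hk, forget_freeGen (Nat.zero_le n), if_pos k.succ_pos,
        eq_comm, map_eq_one_iff _ (MulEquiv.injective _)] at h
      have h0 : 0 < n := by omega
      simp [freeGen, h0] at h

/-! ### Coordinates on the morphisms of the free groupoid -/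

/-- The object of the free groupoid given by a vertex. -/
abbrev pt {n : ℕ} (v : Vertex n) : G n := (Quiver.FreeGroupoid.of _).obj v

/-- The vertex of an object of the free groupoid. -/
def vert {n : ℕ} (a : G n) : Vertex n := a.as

/-- The value of `coord` on a generator. -/
def edgeCoord {n : ℕ} : {a b : Vertex n} → Edge n a b → FreeGroup (Fin n)
  | _, _, .w _ _ => 1
  -- The subtraction is exact because `1 ≤ k`: `l_k^+` carries the `k`-th free generator, whose
  -- index is `k - 1`.
  | _, _, .lPlus k _ _ => freeGen n (k - 1)
  | _, _, .lMinus _ _ _ => 1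

/-- The functor that collapses the maximal tree of the generators `w_k` and `l_k^-`. -/
def collapse (n : ℕ) : G n ⥤ SingleObj (FreeGroup (Fin n))ᵐᵒᵖ :=
  Quiver.FreeGroupoid.lift
    { obj := fun _ => SingleObj.star _
      -- Composition in `SingleObj` reverses multiplication; the opposite group makes `coord`
      -- multiplicative in path order.
      map := fun e => MulOpposite.op (edgeCoord e) }

/-- The element of the free group which a morphism represents when the maximal tree is
collapsed. -/
def coord {n : ℕ} {a b : G n} (m : a ⟶ b) : FreeGroup (Fin n) :=
  MulOpposite.unop ((collapse n).map m : (FreeGroup (Fin n))ᵐᵒᵖ)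

theorem coord_id {n : ℕ} (a : G n) : coord (𝟙 a) = 1 := by
  rw [coord, CategoryTheory.Functor.map_id]
  rfl

theorem coord_comp {n : ℕ} {a b c : G n} (m : a ⟶ b) (m' : b ⟶ c) :
    coord (m ≫ m') = coord m * coord m' := by
  rw [coord, CategoryTheory.Functor.map_comp]
  rfl

theorem coord_inv {n : ℕ} {a b : G n} (m : a ⟶ b) : coord (Groupoid.inv m) = (coord m)⁻¹ := by
  rw [eq_inv_iff_mul_eq_one, ← coord_comp, Groupoid.inv_comp, coord_id]

@[simp]
theorem coord_isoInv {n : ℕ} {a b : G n} (m : a ⟶ b) : coord (inv m) = (coord m)⁻¹ := by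
  rw [← Groupoid.inv_eq_inv, coord_inv]

theorem coord_eqToHom {n : ℕ} {a b : G n} (h : a = b) : coord (eqToHom h) = 1 := by
  subst h
  exact coord_id a

theorem coord_of {n : ℕ} {a b : Vertex n} (e : a ⟶ b) :
    coord ((Quiver.FreeGroupoid.of (Vertex n)).map e) = edgeCoord e := by
  have h : ∀ {φ ψ : Vertex n ⥤q SingleObj (FreeGroup (Fin n))ᵐᵒᵖ} (_ : φ = ψ),
      (show (FreeGroup (Fin n))ᵐᵒᵖ from φ.map e) = ψ.map e := by
    rintro _ _ rfl
    rfl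
  exact congrArg MulOpposite.unop (h (Quiver.FreeGroupoid.lift_spec _))

theorem coord_w {n k : ℕ} (h : k < n) : coord (w k h) = 1 := coord_of _

theorem coord_lPlus {n k : ℕ} (h₁ : 1 ≤ k) (h : k ≤ n) :
    coord (lPlus k h₁ h) = freeGen n (k - 1) := coord_of _

theorem coord_lMinus {n k : ℕ} (h₁ : 1 ≤ k) (h : k ≤ n) : coord (lMinus k h₁ h) = 1 := coord_of _

theorem coord_γ {n k : ℕ} (h : k < n) : coord (γ k h) = 1 := by
  induction k with
  | zero => exact coord_w h
  | succ k ih => simp [γ, coord_comp, ih, coord_w, coord_lMinus]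

theorem coord_f {n : ℕ} (j : Fin n) : coord (f j) = FreeGroup.of j := by
  simp [f, coord_comp, coord_γ, coord_lPlus, coord_lMinus, freeGen]

/-- The homomorphism from the free group to the vertex group that sends the generators to the
loops `f_j`. -/
def loopHom (n : ℕ) : FreeGroup (Fin n) →* (basePoint n ⟶ basePoint n) := FreeGroup.lift f

theorem coord_loopHom {n : ℕ} (x : FreeGroup (Fin n)) : coord (loopHom n x) = x := by
  let c : (basePoint n ⟶ basePoint n) →* FreeGroup (Fin n) :=
    { toFun := coord, map_one' := coord_id _, map_mul' := coord_comp }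
  suffices h : c.comp (loopHom n) = MonoidHom.id _ from DFunLike.congr_fun h x
  ext j
  simp [c, loopHom, coord_f]

/-- The path from the base point to a vertex in the maximal tree. -/
def treePath {n : ℕ} : (v : Vertex n) → (basePoint n ⟶ pt v)
  | .plus 0 _ => 𝟙 _
  | .plus (k + 1) h => γ k h ≫ Groupoid.inv (lMinus (k + 1) (Nat.le_add_left 1 k) h)
  | .minus (k + 1) _ h => γ k h

theorem coord_treePath {n : ℕ} : (v : Vertex n) → coord (treePath v) = 1
  | .plus 0 _ => coord_id _
  | .plus (k + 1) h => by simp [treePath, coord_comp, coord_γ, coord_lMinus]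
  | .minus (k + 1) _ h => coord_γ h

theorem treePath_edge {n : ℕ} {a b : Vertex n} (e : Edge n a b) :
    treePath a ≫ (Quiver.FreeGroupoid.of (Vertex n)).map e ≫ Groupoid.inv (treePath b) =
      loopHom n (edgeCoord e) := by
  rcases e with ⟨k, h⟩ | ⟨k, h₁, h⟩ | ⟨k, h₁, h⟩
  · change treePath _ ≫ w k h ≫ _ = loopHom n 1
    rw [map_one]
    rcases k with _ | k
    · change 𝟙 _ ≫ w 0 h ≫ Groupoid.inv (w 0 h) = 𝟙 _
      simp
    · change (γ k _ ≫ Groupoid.inv (lMinus (k + 1) _ _)) ≫ w (k + 1) h ≫ Groupoid.inv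
        (γ k _ ≫ Groupoid.inv (lMinus (k + 1) _ _) ≫ w (k + 1) h) = 𝟙 _
      simp
  · obtain ⟨k, rfl⟩ : ∃ j, k = j + 1 := ⟨k - 1, by omega⟩
    change γ k h ≫ lPlus (k + 1) h₁ h ≫ Groupoid.inv (γ k h ≫ Groupoid.inv (lMinus (k + 1) h₁ h)) =
      loopHom n (freeGen n k)
    have h' : k < n := h
    simp [freeGen, h', loopHom, f]
  · obtain ⟨k, rfl⟩ : ∃ j, k = j + 1 := ⟨k - 1, by omega⟩
    change (γ k h ≫ Groupoid.inv (lMinus (k + 1) h₁ h)) ≫ lMinus (k + 1) h₁ h ≫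
      Groupoid.inv (γ k h) = loopHom n 1
    rw [map_one]
    change _ = 𝟙 _
    simp

theorem functor_ext_of {n : ℕ} {C : Type*} [Groupoid C] {F F' : G n ⥤ C}
    (h : Quiver.FreeGroupoid.of (Vertex n) ⋙q F.toPrefunctor =
      Quiver.FreeGroupoid.of (Vertex n) ⋙q F'.toPrefunctor) : F = F' :=
  (Quiver.FreeGroupoid.lift_unique _ F h).trans (Quiver.FreeGroupoid.lift_unique _ F' rfl).symm

/-- The path from the base point to an object in the maximal tree. -/
def treePathTo {n : ℕ} (a : G n) : basePoint n ⟶ a := treePath (vert a)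

theorem coord_treePathTo {n : ℕ} (a : G n) : coord (treePathTo a) = 1 := coord_treePath _

/-- Both sides are functors of `m` that send every object to `P`, so it is enough that they agree on
the generating edges, which is `treePath_edge`. -/
theorem treePath_comp {n : ℕ} {a b : G n} (m : a ⟶ b) :
    treePathTo a ≫ m ≫ Groupoid.inv (treePathTo b) = loopHom n (coord m) := by
  let C : G n ⥤ G n :=
    { obj := fun _ => basePoint n
      map := fun {a b} m => treePathTo a ≫ m ≫ Groupoid.inv (treePathTo b)
      map_id := fun a => by simp
      map_comp := fun m m' => by simp }
  let D : G n ⥤ G n :=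
    { obj := fun _ => basePoint n
      map := fun {a b} m => loopHom n (coord m)
      map_id := fun a => by rw [coord_id, map_one]; rfl
      map_comp := fun m m' => by rw [coord_comp, map_mul]; rfl }
  have h : C = D := by
    refine functor_ext_of ?_
    refine Prefunctor.ext (fun _ => rfl) fun a b e => ?_
    exact (treePath_edge e).trans (congrArg (loopHom n) (coord_of e).symm)
  exact (Functor.congr_hom h m).trans
    ((Category.id_comp _).trans (Category.comp_id (loopHom n (coord m))))

theorem coord_injective {n : ℕ} {a b : G n} {m m' : a ⟶ b} (h : coord m = coord m') : m = m' := by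
  have e := treePath_comp m
  rw [h, ← treePath_comp m', cancel_epi, cancel_mono] at e
  exact e

/-- The morphism with given ends and given coordinate. -/
def ofCoord {n : ℕ} (a b : G n) (x : FreeGroup (Fin n)) : a ⟶ b :=
  Groupoid.inv (treePathTo a) ≫ loopHom n x ≫ treePathTo b

theorem coord_ofCoord {n : ℕ} (a b : G n) (x : FreeGroup (Fin n)) : coord (ofCoord a b x) = x := by
  rw [ofCoord, coord_comp, coord_comp, coord_inv, coord_treePathTo, coord_loopHom, coord_treePathTo]
  simp

/-- The vertex group at the base point is free on the loops `f_j`. -/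
noncomputable def loopEquiv (n : ℕ) : FreeGroup (Fin n) ≃* (basePoint n ⟶ basePoint n) :=
  MulEquiv.ofBijective (loopHom n)
    ⟨fun x y h => by rw [← coord_loopHom x, h, coord_loopHom],
      fun m => ⟨coord m, coord_injective (coord_loopHom _)⟩⟩

theorem loopEquiv_of {n : ℕ} (j : Fin n) : loopEquiv n (FreeGroup.of j) = f j :=
  FreeGroup.lift_apply_of ..

theorem coord_loopEquiv {n : ℕ} (x : FreeGroup (Fin n)) : coord (loopEquiv n x) = x :=
  coord_loopHom x

theorem functor_ext {n : ℕ} {F F' : G n ⥤ G n} (h : ∀ a, F.obj a = F'.obj a)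
    (h' : ∀ {a b} (m : a ⟶ b), coord (F.map m) = coord (F'.map m)) : F = F' :=
  CategoryTheory.Functor.ext h fun a b m => coord_injective <| by
    rw [coord_comp, coord_comp, coord_eqToHom, coord_eqToHom, h', one_mul, mul_one]

theorem sends_of_coord {n : ℕ} {F : G n ⥤ G n} {x y x' y' : G n} {m : x ⟶ y} {m' : x' ⟶ y'}
    (hx : F.obj x = x') (hy : F.obj y = y') (h : coord (F.map m) = coord m') : Sends F m m' := by
  subst hx hy
  rw [Sends, coord_injective h]

theorem Sends.coord_eq {n : ℕ} {F : G n ⥤ G n} {x y x' y' : G n} {m : x ⟶ y} {m' : x' ⟶ y'}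
    (h : Sends F m m') : coord (F.map m) = coord m' :=
  congrArg (fun a : Arrow (G n) => coord a.hom) h

/-! ### Automorphisms in coordinates -/

/-- The functor that acts on the objects by `π`, and on the morphisms by the automorphism `α` of
the free group, twisted by `c`. -/
def twistFunctor {n : ℕ} (π : Equiv.Perm (Vertex n)) (α : MulAut (FreeGroup (Fin n)))
    (c : Vertex n → FreeGroup (Fin n)) : G n ⥤ G n where
  obj a := pt (π (vert a))
  map {a b} m := ofCoord _ _ ((c (vert a))⁻¹ * α (coord m) * c (vert b))
  map_id a := coord_injective <| by simp [coord_ofCoord, coord_id]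
  map_comp m m' := coord_injective <| by simp [coord_ofCoord, coord_comp, mul_assoc]

section

variable {n : ℕ} (π π' : Equiv.Perm (Vertex n)) (α α' : MulAut (FreeGroup (Fin n)))
  (c c' : Vertex n → FreeGroup (Fin n))

theorem coord_twistFunctor_map {a b : G n} (m : a ⟶ b) :
    coord ((twistFunctor π α c).map m) = (c (vert a))⁻¹ * α (coord m) * c (vert b) :=
  coord_ofCoord _ _ _

/-- Twists compose by a cocycle rule, which turns relations between automorphisms into identities in
`F_n` at each vertex. -/
theorem twistFunctor_comp : twistFunctor π' α' c' ⋙ twistFunctor π α c =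
    twistFunctor (π * π') (α * α') (fun v => α (c' v) * c (π' v)) := by
  refine functor_ext (fun _ => rfl) fun {a b} m => ?_
  rw [Functor.comp_map, coord_twistFunctor_map, coord_twistFunctor_map, coord_twistFunctor_map]
  simp only [map_mul, map_inv, mul_inv_rev, MulAut.mul_apply, mul_assoc]
  rfl

theorem twistFunctor_one : twistFunctor 1 1 1 = 𝟭 (G n) :=
  functor_ext (fun _ => rfl) fun m => by
    rw [coord_twistFunctor_map]
    simp [CategoryTheory.Functor.id_map]

/-- The automorphism given by `twistFunctor`. -/
def twistAut : Aut (Grpd.of (G n)) where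
  hom := twistFunctor π α c
  inv := twistFunctor π⁻¹ α⁻¹ (fun v => α⁻¹ (c (π⁻¹ v))⁻¹)
  hom_inv_id := by
    refine (twistFunctor_comp _ _ _ _ _ _).trans ?_
    rw [inv_mul_cancel, inv_mul_cancel]
    refine Eq.trans ?_ twistFunctor_one
    congr 1
    funext v
    simp
  inv_hom_id := by
    refine (twistFunctor_comp _ _ _ _ _ _).trans ?_
    rw [mul_inv_cancel, mul_inv_cancel]
    refine Eq.trans ?_ twistFunctor_one
    congr 1
    funext v
    simp

theorem twistAut_mul : twistAut π α c * twistAut π' α' c' =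
    twistAut (π * π') (α * α') (fun v => α (c' v) * c (π' v)) :=
  Iso.ext (twistFunctor_comp π π' α α' c c')

end

/-! ### The action of the braid generators -/

/-- The half turn around the points `m + 1` and `m + 2`, on the vertices. -/
def turn {n m : ℕ} (hm : m + 1 < n) : Vertex n → Vertex n
  | .plus k h =>
    if k = m + 1 then .minus (m + 2) (by omega) hm
    else if k = m + 2 then .minus (m + 1) (by omega) hm.le
    else .plus k h
  | .minus k h₁ h =>
    if k = m + 1 then .plus (m + 2) hm
    else if k = m + 2 then .plus (m + 1) hm.le
    else .minus k h₁ h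

theorem turn_involutive {n m : ℕ} (hm : m + 1 < n) : Function.Involutive (turn hm) := by
  rintro (⟨k, h⟩ | ⟨k, h₁, h⟩)
  all_goals
    by_cases h₂ : k = m + 1
    · subst h₂; simp [turn]
    by_cases h₃ : k = m + 2
    · subst h₃; simp [turn]
    simp [turn, h₂, h₃]

/-- The twist of the action of a braid generator, with respect to the maximal tree. -/
def turnTwist (n m : ℕ) : Vertex n → FreeGroup (Fin n)
  -- The value at `v` is the coordinate of the image, under the formulas for the braid generator, of
  -- the tree path from `P` to `v`. For instance, `w_m` is sent to a path with coordinate `x_m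
  -- x_{m+1}`, the value at `m + 1 - ε`.
  | .plus k _ => if k = m + 1 then freeGen n m else 1
  | .minus k _ _ =>
    if k = m + 1 then freeGen n m * freeGen n (m + 1)
    else if k = m + 2 then freeGen n m
    else 1

/-- The automorphism of the groupoid by which a braid generator acts. -/
def tauAut {n m : ℕ} (hm : m + 1 < n) : Aut (Grpd.of (G n)) :=
  twistAut (turn_involutive hm).toPerm (artinAction n (braidGen n m)) (turnTwist n m)

theorem tauAut_mem {n m : ℕ} (hm : m + 1 < n) : tauAut hm ∈ pointedAut (G n) (basePoint n) := by
  change pt (turn hm (.plus 0 _)) = _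
  simp [turn]

-- The `F_n` automorphisms on the two sides agree because `artinAction` is a homomorphism; there
-- remain the permutations and the twists, compared vertex by vertex.
set_option linter.unusedSimpArgs false in
theorem tauAut_comm {n i j : ℕ} (h : i + 2 ≤ j) (hj : j + 1 < n) :
    tauAut (show i + 1 < n by omega) * tauAut hj = tauAut hj * tauAut (show i + 1 < n by omega) := by
  simp only [tauAut, twistAut_mul, ← map_mul, braidGen_comm n h]
  congr 1
  · ext v
    rcases v with ⟨k, hk⟩ | ⟨k, h₁, hk⟩
    all_goals
      simp only [Equiv.Perm.mul_apply, Function.Involutive.coe_toPerm, turn]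
      split_ifs <;> simp_all [turn] <;> omega
  · funext v
    have e : ∀ k, k = j ∨ k = j + 1 → artinAction n (braidGen n i) (freeGen n k) = freeGen n k :=
      fun k hk => artinAction_braidGen_else (by omega) (by omega)
    have e' : ∀ k, k = i ∨ k = i + 1 → artinAction n (braidGen n j) (freeGen n k) = freeGen n k :=
      fun k hk => artinAction_braidGen_else (by omega) (by omega)
    have := e j (.inl rfl)
    have := e _ (.inr rfl)
    have := e' i (.inl rfl)
    have := e' _ (.inr rfl)
    rcases v with ⟨k, hk⟩ | ⟨k, h₁, hk⟩
    all_goals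
      simp only [Function.Involutive.coe_toPerm, turn, turnTwist]
      split_ifs <;> first | omega | simp_all [turnTwist] <;> omega

set_option linter.unusedSimpArgs false in
theorem tauAut_braid {n i : ℕ} (h : i + 2 < n) :
    tauAut (show i + 1 < n by omega) * tauAut (show i + 1 + 1 < n from h) *
      tauAut (show i + 1 < n by omega) =
    tauAut (show i + 1 + 1 < n from h) * tauAut (show i + 1 < n by omega) *
      tauAut (show i + 1 + 1 < n from h) := by
  simp only [tauAut, twistAut_mul, ← map_mul, braidGen_braid h]
  congr 1
  · ext v
    rcases v with ⟨k, hk⟩ | ⟨k, h₁, hk⟩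
    all_goals
      simp only [Equiv.Perm.mul_apply, Function.Involutive.coe_toPerm]
      by_cases h₂ : k = i + 1
      · subst h₂; simp [turn]
      by_cases h₃ : k = i + 2
      · subst h₃; simp [turn]
      by_cases h₄ : k = i + 3
      · subst h₄; simp [turn]
      simp [turn, h₂, h₃, h₄]
  · funext v
    have e₁ : artinAction n (braidGen n i) (freeGen n (i + 1 + 1)) = freeGen n (i + 1 + 1) :=
      artinAction_braidGen_else (by omega) (by omega)
    have e₂ : artinAction n (braidGen n (i + 1)) (freeGen n i) = freeGen n i :=
      artinAction_braidGen_else (by omega) (by omega)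
    have e₃ := artinAction_braidGen_self (show i + 1 < n by omega)
    have e₄ := artinAction_braidGen_succ (show i + 1 < n by omega)
    have e₅ := artinAction_braidGen_self (show i + 1 + 1 < n from h)
    have e₆ := artinAction_braidGen_succ (show i + 1 + 1 < n from h)
    rcases v with ⟨k, hk⟩ | ⟨k, h₁, hk⟩
    all_goals
      simp only [Function.Involutive.coe_toPerm]
      by_cases h₂ : k = i + 1
      · subst h₂; simp [turn, turnTwist, e₁, e₂, e₃, e₄, e₅, e₆, mul_assoc]
      by_cases h₃ : k = i + 2
      · subst h₃; simp [turn, turnTwist, e₁, e₂, e₃, e₄, e₅, e₆, mul_assoc]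
      by_cases h₄ : k = i + 3
      · subst h₄; simp [turn, turnTwist, e₁, e₂, e₃, e₄, e₅, e₆, mul_assoc]
      simp [turn, turnTwist, h₂, h₃, h₄]

theorem isTau_tauAut {n m : ℕ} (hm : m + 1 < n) : IsTau m hm (functorOf (tauAut hm)) := by
  -- Each formula amounts to three equalities: of sources, of targets and of coordinates.
  have key : ∀ {a b a' b' : Vertex n} (x : pt a ⟶ pt b) (y : pt a' ⟶ pt b'),
      turn hm a = a' → turn hm b = b' →
      (turnTwist n m a)⁻¹ * artinAction n (braidGen n m) (coord x) * turnTwist n m b = coord y →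
      Sends (functorOf (tauAut hm)) x y := fun x y h₁ h₂ h₃ =>
    sends_of_coord (congrArg pt h₁) (congrArg pt h₂) ((coord_twistFunctor_map _ _ _ x).trans h₃)
  constructor
  · intro j hj h₁ h₂ h₃
    refine key _ _ ?_ ?_ ?_ <;> simp [turn, turnTwist, coord_w, h₁, h₂, h₃]
  · refine key _ _ ?_ ?_ ?_ <;> simp [turn, turnTwist, coord_w, coord_comp, coord_lPlus]
  · refine key _ _ ?_ ?_ ?_ <;> simp [turn, turnTwist, coord_w]
  · intro h
    refine key _ _ ?_ ?_ ?_ <;>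
      simp [turn, turnTwist, coord_w, coord_comp, coord_lMinus]
  · intro j h₁ hj h₂ h₃
    refine key _ _ ?_ ?_ ?_
    · simp [turn, h₂, h₃]
    · simp [turn, h₂, h₃]
    · rw [coord_lPlus, artinAction_braidGen_else (by omega) (by omega)]
      simp [turnTwist, h₂, h₃]
  · intro j h₁ hj h₂ h₃
    refine key _ _ ?_ ?_ ?_ <;> simp [turn, turnTwist, coord_lMinus, h₂, h₃]
  · refine key _ _ ?_ ?_ ?_ <;>
      simp [turn, turnTwist, coord_lPlus, coord_lMinus, artinAction_braidGen_self hm, mul_assoc]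
  · refine key _ _ ?_ ?_ ?_ <;> simp [turn, turnTwist, coord_lPlus, coord_lMinus]
  · refine key _ _ ?_ ?_ ?_ <;>
      simp [turn, turnTwist, coord_lPlus, coord_lMinus, artinAction_braidGen_succ hm]
  · refine key _ _ ?_ ?_ ?_ <;> simp [turn, turnTwist, coord_lPlus, coord_lMinus]

/-- A functor is determined by its values on the generators if there are any. -/
theorem functor_eq_of_sends {n : ℕ} (hn : 0 < n) {F F' : G n ⥤ G n}
    (h : ∀ {a b : Vertex n} (e : a ⟶ b), Sends F ((Quiver.FreeGroupoid.of _).map e)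
      (F'.map ((Quiver.FreeGroupoid.of _).map e))) : F = F' := by
  have left : ∀ {a b : Vertex n} (_ : a ⟶ b), F.obj (pt a) = F'.obj (pt a) := fun e =>
    congrArg (fun x : Arrow (G n) => x.left) (h e)
  -- Every vertex is the source of some generator; for the base point this is `w_0`, which requires
  -- `0 < n`.
  have hobj : ∀ a : Vertex n, F.obj (pt a) = F'.obj (pt a) := by
    rintro (⟨k, hk⟩ | ⟨k, h₁, hk⟩)
    · rcases Nat.eq_zero_or_pos k with rfl | h₁
      · exact left (Edge.w 0 hn)
      · exact left (Edge.lMinus k h₁ hk)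
    · exact left (Edge.lPlus k h₁ hk)
  refine functor_ext_of (Prefunctor.ext hobj fun a b e => ?_)
  -- Equality of arrows is converted into the equality up to transport that `Prefunctor.ext` asks
  -- for.
  have key : ∀ {x y x' y' : G n} (m : x ⟶ y) (m' : x' ⟶ y') (hx : x' = x) (hy : y' = y),
      Arrow.mk m = Arrow.mk m' → m = Eq.recOn hy (Eq.recOn hx m') := by
    rintro x y _ _ m m' rfl rfl hm
    exact coord_injective (congrArg (fun a : Arrow (G n) => coord a.hom) hm)
  exact key _ _ (hobj a).symm (hobj b).symm (h e)

theorem IsTau.unique {n m : ℕ} {hm : m + 1 < n} {F F' : G n ⥤ G n} (h : IsTau m hm F)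
    (h' : IsTau m hm F') : F = F' := by
  refine functor_eq_of_sends (by omega) fun {a b} e => ?_
  have key : ∀ {x y x' y' : G n} {m : x ⟶ y} {m' : x' ⟶ y'}, Sends F m m' → Sends F' m m' →
      Sends F m (F'.map m) := fun h₁ h₂ => Eq.trans h₁ (Eq.symm h₂)
  rcases e with ⟨k, hk⟩ | ⟨k, h₁, hk⟩ | ⟨k, h₁, hk⟩
  · by_cases h₂ : k = m
    · subst h₂; exact key h.w_pred h'.w_pred
    by_cases h₃ : k = m + 1
    · subst h₃; exact key h.w_self h'.w_self
    by_cases h₄ : k = m + 2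
    · subst h₄; exact key (h.w_succ hk) (h'.w_succ hk)
    · exact key (h.w_else k hk h₂ h₃ h₄) (h'.w_else k hk h₂ h₃ h₄)
  · by_cases h₂ : k = m + 1
    · subst h₂; exact key h.lPlus_self h'.lPlus_self
    by_cases h₃ : k = m + 2
    · subst h₃; exact key h.lPlus_succ h'.lPlus_succ
    · exact key (h.lPlus_else k h₁ hk h₂ h₃) (h'.lPlus_else k h₁ hk h₂ h₃)
  · by_cases h₂ : k = m + 1
    · subst h₂; exact key h.lMinus_self h'.lMinus_self
    by_cases h₃ : k = m + 2
    · subst h₃; exact key h.lMinus_succ h'.lMinus_succ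
    · exact key (h.lMinus_else k h₁ hk h₂ h₃) (h'.lMinus_else k h₁ hk h₂ h₃)

/-- The action of the braid group on the free groupoid. -/
def groupoidAction (n : ℕ) : BraidGroup n →* pointedAut (G n) (basePoint n) :=
  braidLift (fun m => if hm : m + 1 < n then ⟨tauAut hm, tauAut_mem hm⟩ else 1)
    (fun i j h hj => by
      rw [dif_pos (by omega), dif_pos hj]
      exact Subtype.ext (tauAut_comm h hj))
    (fun i h => by
      rw [dif_pos (by omega), dif_pos (by omega)]
      exact Subtype.ext (tauAut_braid h))

theorem groupoidAction_braidGen {n m : ℕ} (hm : m + 1 < n) :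
    groupoidAction n (braidGen n m) = ⟨tauAut hm, tauAut_mem hm⟩ := by
  rw [groupoidAction, braidLift_braidGen _ _ _ hm, dif_pos hm]

theorem isTau_groupoidAction {n m : ℕ} (hm : m + 1 < n) :
    IsTau m hm (functorOf (groupoidAction n (braidGen n m)).1) := by
  rw [groupoidAction_braidGen hm]
  exact isTau_tauAut hm

/-- On the vertex group at the base point the action is Artin's action. -/
theorem groupoidAction_sends {n : ℕ} (β : BraidGroup n) (x : FreeGroup (Fin n)) :
    Sends (functorOf (groupoidAction n β).1) (loopEquiv n x)
      (loopEquiv n (artinAction n β x)) := by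
  -- `Sends` is an equality in the arrow category, on which automorphisms act; products and inverses
  -- can thus be handled without transports.
  let act (F : Aut (Grpd.of (G n))) (a : Arrow (G n)) : Arrow (G n) :=
    (functorOf F).mapArrow.obj a
  have act_mul : ∀ F F' a, act (F * F') a = act F (act F' a) := fun _ _ _ => rfl
  let H : Subgroup (BraidGroup n) :=
    { carrier := {β | ∀ x, act (groupoidAction n β).1 (Arrow.mk (loopEquiv n x)) =
        Arrow.mk (loopEquiv n (artinAction n β x))}
      one_mem' := fun x => by rw [map_one, map_one]; rfl
      mul_mem' := fun {a b} ha hb x => by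
        rw [map_mul, Subgroup.coe_mul, act_mul, hb, ha, map_mul, MulAut.mul_apply]
      inv_mem' := fun {a} ha x => by
        have e := ha ((artinAction n a)⁻¹ x)
        rw [MulAut.apply_inv_self] at e
        rw [← e, ← act_mul, ← Subgroup.coe_mul, ← map_mul, inv_mul_cancel, map_one, map_inv]
        rfl }
  refine braidGroup_mem H (fun m hm x => ?_) β x
  rw [groupoidAction_braidGen hm]
  -- The half turn fixes `P` and the twist at `P` is `1`, so on loops at `P` only the automorphism
  -- of `F_n` remains.
  have e : turn hm (.plus 0 (Nat.zero_le n)) = .plus 0 (Nat.zero_le n) := by simp [turn]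
  refine sends_of_coord (F := functorOf (tauAut hm)) (congrArg pt e) (congrArg pt e) ?_
  refine (coord_twistFunctor_map _ _ _ _).trans ?_
  change (turnTwist n m (.plus 0 _))⁻¹ * artinAction n _ (coord (loopEquiv n x)) *
    turnTwist n m (.plus 0 _) = coord (loopEquiv n _)
  rw [coord_loopEquiv, coord_loopEquiv]
  simp [turnTwist]

theorem groupoidAction_injective (n : ℕ) : Function.Injective (groupoidAction n) := by
  intro a b h
  refine artinAction_injective n (MulEquiv.ext fun x => ?_)
  have ha := (groupoidAction_sends a x).coord_eq
  have hb := (groupoidAction_sends b x).coord_eq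
  rw [coord_loopEquiv] at ha hb
  rw [← ha, ← hb, h]

theorem groupoidAction_unique {n : ℕ} (ψ : BraidGroup n →* pointedAut (G n) (basePoint n))
    (h : ∀ (i : ℕ) (hi : i + 1 < n), IsTau i hi (functorOf (ψ (braidGen n i)).1)) :
    ψ = groupoidAction n :=
  braidHom_apply_eq fun i hi =>
    Subtype.ext (Iso.ext ((h i hi).unique (isTau_groupoidAction hi)))

end PlaneGroupoid

theorem mainTheorem4 (n : ℕ) :
    ∃ φ : PlaneGroupoid.BraidGroup n →*
        PlaneGroupoid.pointedAut (PlaneGroupoid.G n) (PlaneGroupoid.basePoint n),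
      -- each braid generator acts by the given formulas
      (∀ i : Fin (n - 1),
        PlaneGroupoid.IsTau i (by omega) (PlaneGroupoid.functorOf (φ (PlaneGroupoid.τ i)).1)) ∧
      -- the formulas determine the homomorphism
      (∀ ψ : PlaneGroupoid.BraidGroup n →*
          PlaneGroupoid.pointedAut (PlaneGroupoid.G n) (PlaneGroupoid.basePoint n),
        (∀ i : Fin (n - 1), PlaneGroupoid.IsTau i (by omega)
          (PlaneGroupoid.functorOf (ψ (PlaneGroupoid.τ i)).1)) → ψ = φ) ∧
      -- it is an imbedding
      Function.Injective φ ∧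
      -- the vertex group at the base point is free on the loops `f_1, …, f_n`,
      -- and the action restricts to Artin's action there, which is faithful
      (∃ θ : FreeGroup (Fin n) ≃* (PlaneGroupoid.basePoint n ⟶ PlaneGroupoid.basePoint n),
        (∀ j : Fin n, θ (FreeGroup.of j) = PlaneGroupoid.f j) ∧
        (∀ (β : PlaneGroupoid.BraidGroup n) (x : FreeGroup (Fin n)),
          PlaneGroupoid.Sends (PlaneGroupoid.functorOf (φ β).1) (θ x)
            (θ (PlaneGroupoid.artinAction n β x)))) ∧
      Function.Injective (PlaneGroupoid.artinAction n) := by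

  refine ⟨PlaneGroupoid.groupoidAction n, fun i => ?_, fun ψ hψ => ?_,
    PlaneGroupoid.groupoidAction_injective n,
    ⟨PlaneGroupoid.loopEquiv n, PlaneGroupoid.loopEquiv_of, PlaneGroupoid.groupoidAction_sends⟩,
    PlaneGroupoid.artinAction_injective n⟩
  · rw [← PlaneGroupoid.braidGen_val]
    exact PlaneGroupoid.isTau_groupoidAction _
  · refine PlaneGroupoid.groupoidAction_unique ψ fun i hi => ?_
    have h := hψ ⟨i, by omega⟩
    rwa [← PlaneGroupoid.braidGen_val] at h
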